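/- Let $\mathcal F$ be a regular foliation by curves of the torus $\mathbb T^2=S^1\times S^1$, that is, a smooth subbundle of rank one of $T\mathbb T^2$ (every such line field is integrable). Let $\mathcal F\otimes_{\mathbb R}\mathbb C$ be the complexification of the line bundle $\mathcal F$ and let $N=\Lambda^1_{\mathbb C}(\mathcal F\otimes_{\mathbb R}\mathbb C)$ be its complex determinant bundle. A metaplectic correction of $\mathcal F$ is a square root of $N$, that is, a smooth complex line bundle $L$ over $\mathbb T^2$ such that $L\otimes_{\mathbb C} L\cong N$ as smooth complex line bundles. Then: 1. $\mathcal F$ admits a metaplectic correction; 2. $c_1(\mathcal F\otimes_{\mathbb R}\mathbb C)=0$ in $H^2(\mathbb T^2;\mathbb Z)$; 3. $N$ is isomorphic, as a smooth complex line bundle, to the trivial bundle $\mathbb T^2\times\mathbb C$; 4. the trivial bundle $\mathbb T^2\times\mathbb C$ is a square root of $N$ (the standard metaplectic correction). -/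

import Mathlib

open Bundle Set TensorProduct
open scoped Manifold ContDiff Topology

noncomputable section

/-! ### Smooth complex line bundles over real manifolds

A complex line bundle over `M` is given by Mathlib's classes `FiberBundle ℂ L` and
`VectorBundle ℂ ℂ L`, for a family `L` of complex vector spaces. -/

section LineBundles

variable {EM H M : Type*} [NormedAddCommGroup EM] [NormedSpace ℝ EM] [TopologicalSpace H]
  [TopologicalSpace M] [ChartedSpace H M]

/-- A complex line bundle over a real manifold is smooth if its (complex linear) transition
functions are smooth over `ℝ`. This is `ContMDiffVectorBundle` with `ℂ`-linear transition functions
over a base that is a manifold over `ℝ`. -/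
def IsSmoothComplexLineBundle (I : ModelWithCorners ℝ EM H) (L : M → Type*)
    [∀ x, AddCommGroup (L x)] [∀ x, Module ℂ (L x)] [TopologicalSpace (TotalSpace ℂ L)]
    [∀ x, TopologicalSpace (L x)] [FiberBundle ℂ L] [VectorBundle ℂ ℂ L] : Prop :=
  ∀ (e e' : Trivialization ℂ (π ℂ L)) [MemTrivializationAtlas e] [MemTrivializationAtlas e'],
    ContMDiffOn I 𝓘(ℝ, ℂ →L[ℂ] ℂ) ∞ (fun b : M => (e.coordChangeL ℂ e' b : ℂ →L[ℂ] ℂ))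
      (e.baseSet ∩ e'.baseSet)

/-- The section `s` of the complex line bundle `L` is smooth at `x₀`. -/
def SmoothSectionAt (I : ModelWithCorners ℝ EM H) {L : M → Type*}
    [TopologicalSpace (TotalSpace ℂ L)] [∀ x, TopologicalSpace (L x)] [FiberBundle ℂ L]
    (s : ∀ x, L x) (x₀ : M) : Prop :=
  ContMDiffAt I (I.prod 𝓘(ℝ, ℂ)) ∞ (fun x => TotalSpace.mk' ℂ x (s x)) x₀

/-- `φ` is an isomorphism of smooth complex line bundles from `L` to `N`: a family of complex linear
isomorphisms of the fibres which identifies the smooth local sections of `L` and of `N`. -/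
def IsSmoothLineBundleIso (I : ModelWithCorners ℝ EM H) {L N : M → Type*}
    [∀ x, AddCommGroup (L x)] [∀ x, Module ℂ (L x)] [TopologicalSpace (TotalSpace ℂ L)]
    [∀ x, TopologicalSpace (L x)] [FiberBundle ℂ L]
    [∀ x, AddCommGroup (N x)] [∀ x, Module ℂ (N x)] [TopologicalSpace (TotalSpace ℂ N)]
    [∀ x, TopologicalSpace (N x)] [FiberBundle ℂ N] (φ : ∀ x, L x ≃ₗ[ℂ] N x) : Prop :=
  ∀ (x₀ : M) (s : ∀ x, L x),
    SmoothSectionAt I s x₀ ↔ SmoothSectionAt I (fun x => φ x (s x)) x₀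

/-- `L` is a square root of `N`: there is an isomorphism `L ⊗ L ≅ N` of smooth complex line bundles.
It is given by complex linear isomorphisms `L x ⊗ L x ≃ N x`; since `L ⊗ L` is locally spanned by
the products `s ⊗ t` of smooth local sections of `L`, smoothness says that these products go to
smooth local sections of `N` (the inverse of a smooth bijective morphism of line bundles is
smooth). -/
def IsSquareRoot (I : ModelWithCorners ℝ EM H) (L N : M → Type*)
    [∀ x, AddCommGroup (L x)] [∀ x, Module ℂ (L x)] [TopologicalSpace (TotalSpace ℂ L)]
    [∀ x, TopologicalSpace (L x)] [FiberBundle ℂ L]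
    [∀ x, AddCommGroup (N x)] [∀ x, Module ℂ (N x)] [TopologicalSpace (TotalSpace ℂ N)]
    [∀ x, TopologicalSpace (N x)] [FiberBundle ℂ N] : Prop :=
  ∃ φ : ∀ x, L x ⊗[ℂ] L x ≃ₗ[ℂ] N x, ∀ (x₀ : M) (s t : ∀ x, L x),
    SmoothSectionAt I s x₀ → SmoothSectionAt I t x₀ →
      SmoothSectionAt I (fun x => φ x (s x ⊗ₜ[ℂ] t x)) x₀

/-- A system of local frames, with smooth transition functions, of a family of complex lines. -/
structure LineFrameAtlas (I : ModelWithCorners ℝ EM H) (E : M → Type*)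
    [∀ x, AddCommGroup (E x)] [∀ x, Module ℂ (E x)] where
  Index : Type*
  dom : Index → Set M
  frame : Index → ∀ x, E x
  isOpen_dom : ∀ i, IsOpen (dom i)
  exists_mem_dom : ∀ x, ∃ i, x ∈ dom i
  bijective : ∀ i, ∀ x ∈ dom i, Function.Bijective (fun c : ℂ => c • frame i x)
  smooth_transition : ∀ i j, ∃ g : M → ℂ, ContMDiffOn I 𝓘(ℝ, ℂ) ∞ g (dom i ∩ dom j) ∧
    ∀ x ∈ dom i ∩ dom j, frame i x = g x • frame j x

namespace LineFrameAtlas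

variable {I : ModelWithCorners ℝ EM H} {E : M → Type*}
  [∀ x, AddCommGroup (E x)] [∀ x, Module ℂ (E x)] (A : LineFrameAtlas I E)

/-- The linear isomorphism `c ↦ c • frame i x`. -/
def equiv (i : A.Index) (x : M) (hx : x ∈ A.dom i) : ℂ ≃ₗ[ℂ] E x :=
  LinearEquiv.ofBijective (LinearMap.toSpanSingleton ℂ (E x) (A.frame i x)) (A.bijective i x hx)

theorem equiv_apply (i : A.Index) (x : M) (hx : x ∈ A.dom i) (c : ℂ) :
    A.equiv i x hx c = c • A.frame i x := rfl

open Classical in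
/-- The coordinate of `v` with respect to the frame `i` (zero outside its domain). -/
def coord (i : A.Index) (x : M) (v : E x) : ℂ :=
  if hx : x ∈ A.dom i then (A.equiv i x hx).symm v else 0

theorem coord_of_mem {i : A.Index} {x : M} (hx : x ∈ A.dom i) (v : E x) :
    A.coord i x v = (A.equiv i x hx).symm v := dif_pos hx

theorem coord_smul_frame {i : A.Index} {x : M} (hx : x ∈ A.dom i) (c : ℂ) :
    A.coord i x (c • A.frame i x) = c := by
  rw [A.coord_of_mem hx, ← A.equiv_apply i x hx, LinearEquiv.symm_apply_apply]

theorem coord_smul_frame' {i : A.Index} {x : M} (hx : x ∈ A.dom i) (v : E x) :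
    A.coord i x v • A.frame i x = v := by
  rw [A.coord_of_mem hx, ← A.equiv_apply i x hx, LinearEquiv.apply_symm_apply]

/-- The local trivialization `v ↦ (x, coordinate of v)`, for `v` in the fibre over `x`. -/
def pretriv (i : A.Index) : Pretrivialization ℂ (π ℂ E) where
  toFun p := (p.1, A.coord i p.1 p.2)
  invFun q := ⟨q.1, q.2 • A.frame i q.1⟩
  source := π ℂ E ⁻¹' A.dom i
  target := A.dom i ×ˢ univ
  map_source' p hp := ⟨hp, mem_univ _⟩
  map_target' q hq := hq.1
  left_inv' p hp := by
    obtain ⟨x, v⟩ := p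
    have hx : x ∈ A.dom i := hp
    simp [A.coord_smul_frame' hx]
  right_inv' q hq := by
    obtain ⟨x, c⟩ := q
    have hx : x ∈ A.dom i := hq.1
    simp [A.coord_smul_frame hx]
  open_target := (A.isOpen_dom i).prod isOpen_univ
  baseSet := A.dom i
  open_baseSet := A.isOpen_dom i
  source_eq := rfl
  target_eq := rfl
  proj_toFun _ _ := rfl

theorem pretriv_apply (i : A.Index) (x : M) (v : E x) :
    A.pretriv i ⟨x, v⟩ = (x, A.coord i x v) := rfl

theorem pretriv_symm (i : A.Index) {x : M} (hx : x ∈ A.dom i) (c : ℂ) :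
    (A.pretriv i).symm x c = c • A.frame i x := by
  rw [Pretrivialization.symm_apply _ hx]
  rfl

instance pretriv_isLinear (i : A.Index) : (A.pretriv i).IsLinear ℂ where
  linear x hx := by
    have hx' : x ∈ A.dom i := hx
    constructor <;> intros <;> simp [pretriv_apply, A.coord_of_mem hx']

/-- The smooth transition functions, as linear maps. -/
theorem exists_coordChange (i j : A.Index) :
    ∃ f : M → ℂ →L[ℂ] ℂ, ContMDiffOn I 𝓘(ℝ, ℂ →L[ℂ] ℂ) ∞ f (A.dom i ∩ A.dom j) ∧
      ∀ b ∈ A.dom i ∩ A.dom j, ∀ v : ℂ,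
        f b v = (A.pretriv j ⟨b, (A.pretriv i).symm b v⟩).2 := by
  obtain ⟨g, hg, hgij⟩ := A.smooth_transition i j
  refine ⟨fun b => g b • ContinuousLinearMap.id ℂ ℂ, ?_, ?_⟩
  · exact ((ContinuousLinearMap.toSpanSingleton ℂ (ContinuousLinearMap.id ℂ ℂ)).restrictScalars
      ℝ).contDiff.contMDiff.comp_contMDiffOn hg
  · intro b hb v
    rw [A.pretriv_symm i hb.1, pretriv_apply, hgij b hb, smul_smul, A.coord_smul_frame hb.2]
    simp [mul_comm]

variable [∀ x, TopologicalSpace (E x)] [∀ x, IsModuleTopology ℂ (E x)]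

/-- The vector bundle structure whose trivializations are the given local frames. -/
def prebundle : VectorPrebundle ℂ ℂ E where
  pretrivializationAtlas := range A.pretriv
  pretrivialization_linear' := by
    rintro _ ⟨i, rfl⟩
    infer_instance
  pretrivializationAt x := A.pretriv (A.exists_mem_dom x).choose
  mem_base_pretrivializationAt x := (A.exists_mem_dom x).choose_spec
  pretrivialization_mem_atlas x := mem_range_self _
  exists_coordChange := by
    rintro _ ⟨i, rfl⟩ _ ⟨j, rfl⟩
    obtain ⟨f, hf, hfij⟩ := A.exists_coordChange i j
    exact ⟨f, hf.continuousOn, hfij⟩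
  totalSpaceMk_isInducing x := by
    have hx := (A.exists_mem_dom x).choose_spec
    set i := (A.exists_mem_dom x).choose
    have : ContinuousAdd (E x) := IsModuleTopology.toContinuousAdd ℂ (E x)
    have : ContinuousSMul ℂ (E x) := IsModuleTopology.toContinuousSMul ℂ (E x)
    have h1 : Continuous (A.equiv i x hx) :=
      IsModuleTopology.continuous_of_linearMap (A.equiv i x hx).toLinearMap
    have h2 : Continuous (A.equiv i x hx).symm :=
      IsModuleTopology.continuous_of_linearMap (A.equiv i x hx).symm.toLinearMap
    have h3 : Topology.IsInducing (A.equiv i x hx).symm :=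
      (Homeomorph.mk (A.equiv i x hx).symm.toEquiv h2 h1).isInducing
    have h4 : (A.pretriv i ∘ TotalSpace.mk x : E x → M × ℂ) =
        (fun c : ℂ => (x, c)) ∘ (A.equiv i x hx).symm := by
      funext v
      simp [pretriv_apply, A.coord_of_mem hx]
    rw [h4]
    exact (isEmbedding_prodMkRight x).isInducing.comp h3

theorem prebundle_isSmooth :
    letI := A.prebundle.totalSpaceTopology
    letI := A.prebundle.toFiberBundle
    haveI := A.prebundle.toVectorBundle
    IsSmoothComplexLineBundle I E := by
  let := A.prebundle.totalSpaceTopology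
  let := A.prebundle.toFiberBundle
  have := A.prebundle.toVectorBundle
  rintro _ _ ⟨e, ⟨i, rfl⟩, rfl⟩ ⟨e', ⟨j, rfl⟩, rfl⟩
  obtain ⟨f, hf, hfij⟩ := A.exists_coordChange i j
  refine hf.congr fun b hb => ?_
  ext
  have hh := hfij b hb 1
  rw [hh, ContinuousLinearEquiv.coe_coe, Trivialization.coordChangeL_apply]
  exacts [rfl, hb]

end LineFrameAtlas

end LineBundles

/-! ### One-dimensional foliations and their complexified tangent bundles -/

section Foliations

variable {EM H M : Type*} [NormedAddCommGroup EM] [NormedSpace ℝ EM] [TopologicalSpace H]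
  [TopologicalSpace M] [ChartedSpace H M]

/-- A regular foliation by curves, given by its tangent line field: a smooth subbundle of rank one
of the tangent bundle (such a subbundle is automatically involutive, hence integrable). -/
structure RegularFoliation (I : ModelWithCorners ℝ EM H) (M : Type*) [TopologicalSpace M]
    [ChartedSpace H M] [IsManifold I ∞ M] where
  /-- The line tangent to the leaf through `x`. -/
  line : ∀ x : M, Submodule ℝ (TangentSpace I x)
  finrank_line : ∀ x, Module.finrank ℝ (line x) = 1
  exists_local_frame : ∀ x₀ : M, ∃ (U : Set M) (X : ∀ x : M, TangentSpace I x),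
    IsOpen U ∧ x₀ ∈ U ∧ ContMDiffOn I I.tangent ∞ (fun x => (⟨x, X x⟩ : TangentBundle I M)) U ∧
      ∀ x ∈ U, X x ∈ line x ∧ X x ≠ 0

namespace RegularFoliation

variable {I : ModelWithCorners ℝ EM H} [IsManifold I ∞ M] (F : RegularFoliation I M)

/-- A smooth nowhere vanishing vector field tangent to the foliation on an open set. -/
structure LocalFrame where
  dom : Set M
  field : ∀ x : M, TangentSpace I x
  isOpen_dom : IsOpen dom
  smooth : ContMDiffOn I I.tangent ∞ (fun x => (⟨x, field x⟩ : TangentBundle I M)) dom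
  mem : ∀ x ∈ dom, field x ∈ F.line x
  ne_zero : ∀ x ∈ dom, field x ≠ 0

theorem exists_mem_dom (x : M) : ∃ X : F.LocalFrame, x ∈ X.dom := by
  obtain ⟨U, X, hU, hx, hX, h⟩ := F.exists_local_frame x
  exact ⟨⟨U, X, hU, hX, fun x hx => (h x hx).1, fun x hx => (h x hx).2⟩, hx⟩

open Classical in
/-- The value of a local frame in the line at `x` (zero outside the domain). -/
def LocalFrame.val {F : RegularFoliation I M} (X : F.LocalFrame) (x : M) : F.line x :=
  if hx : x ∈ X.dom then ⟨X.field x, X.mem x hx⟩ else 0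

theorem LocalFrame.coe_val {F : RegularFoliation I M} (X : F.LocalFrame) {x : M} (hx : x ∈ X.dom) :
    (X.val x : TangentSpace I x) = X.field x := by
  simp [LocalFrame.val, hx]

theorem LocalFrame.val_ne_zero {F : RegularFoliation I M} (X : F.LocalFrame) {x : M}
    (hx : x ∈ X.dom) : X.val x ≠ 0 := fun h => X.ne_zero x hx (by simp [← X.coe_val hx, h])

theorem LocalFrame.bijective {F : RegularFoliation I M} (X : F.LocalFrame) {x : M}
    (hx : x ∈ X.dom) : Function.Bijective (fun c : ℝ => c • X.val x) := by
  refine ⟨fun a b hab => smul_left_injective ℝ (X.val_ne_zero hx) hab, fun v => ?_⟩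
  exact (finrank_eq_one_iff_of_nonzero' _ (X.val_ne_zero hx)).1 (F.finrank_line x) v

/-- Two local frames differ by a smooth function. -/
theorem LocalFrame.exists_transition {F : RegularFoliation I M} (X Y : F.LocalFrame) :
    ∃ a : M → ℝ, ContMDiffOn I 𝓘(ℝ, ℝ) ∞ a (X.dom ∩ Y.dom) ∧
      ∀ x ∈ X.dom ∩ Y.dom, X.val x = a x • Y.val x := by
  have h1 : ∀ x, ∃ a : ℝ, x ∈ X.dom ∩ Y.dom → X.val x = a • Y.val x := by
    intro x
    by_cases hx : x ∈ X.dom ∩ Y.dom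
    · obtain ⟨a, ha⟩ := (Y.bijective hx.2).2 (X.val x)
      exact ⟨a, fun _ => ha.symm⟩
    · exact ⟨0, fun h => absurd h hx⟩
  choose a ha using h1
  refine ⟨a, fun x₀ hx₀ => ContMDiffAt.contMDiffWithinAt ?_, ha⟩
  set e := trivializationAt EM (TangentSpace I : M → Type _) x₀ with he
  have hX := (contMDiffAt_section (F := EM) (E := (TangentSpace I : M → Type _)) x₀).1
    (X.smooth.contMDiffAt (X.isOpen_dom.mem_nhds hx₀.1))
  have hY := (contMDiffAt_section (F := EM) (E := (TangentSpace I : M → Type _)) x₀).1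
    (Y.smooth.contMDiffAt (Y.isOpen_dom.mem_nhds hx₀.2))
  have hbase : x₀ ∈ e.baseSet := mem_baseSet_trivializationAt EM _ x₀
  have hY0 : (e ⟨x₀, Y.field x₀⟩).2 ≠ 0 := by
    intro h
    apply Y.ne_zero x₀ hx₀.2
    have hz : (e ⟨x₀, 0⟩).2 = 0 := (e.linear ℝ hbase).map_zero
    exact (e.continuousLinearEquivAt ℝ x₀ hbase).injective (h.trans hz.symm)
  obtain ⟨l, hl⟩ := SeparatingDual.exists_ne_zero (R := ℝ) hY0
  have hlX : ContMDiffAt I 𝓘(ℝ, ℝ) ∞ (fun x => l (e ⟨x, X.field x⟩).2) x₀ :=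
    l.contDiff.contMDiff.contMDiffAt.comp x₀ hX
  have hlY : ContMDiffAt I 𝓘(ℝ, ℝ) ∞ (fun x => l (e ⟨x, Y.field x⟩).2) x₀ :=
    l.contDiff.contMDiff.contMDiffAt.comp x₀ hY
  have hne : ∀ᶠ x in 𝓝 x₀, l (e ⟨x, Y.field x⟩).2 ≠ 0 := hlY.continuousAt.eventually_ne hl
  refine (hlX.div₀ hlY hl).congr_of_eventuallyEq ?_
  filter_upwards [hne, e.open_baseSet.mem_nhds hbase, X.isOpen_dom.mem_nhds hx₀.1,
    Y.isOpen_dom.mem_nhds hx₀.2] with x hx hxe hxX hxY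
  have h2 : X.field x = a x • Y.field x := by
    have := congrArg (Subtype.val) (ha x ⟨hxX, hxY⟩)
    rwa [Submodule.coe_smul, X.coe_val hxX, Y.coe_val hxY] at this
  have h3 : (e ⟨x, X.field x⟩).2 = a x • (e ⟨x, Y.field x⟩).2 := by
    rw [h2]
    exact (e.linear ℝ hxe).map_smul _ _
  rw [Pi.div_apply, h3, map_smul, smul_eq_mul, mul_div_cancel_right₀ _ hx]

/-- The fibre at `x` of the complexification `F ⊗ ℂ` of the tangent line bundle of `F`. -/
def Complexified (x : M) : Type _ := ℂ ⊗[ℝ] F.line x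

instance (x : M) : AddCommGroup (F.Complexified x) := inferInstanceAs (AddCommGroup (ℂ ⊗[ℝ] F.line x))

instance (x : M) : Module ℂ (F.Complexified x) := inferInstanceAs (Module ℂ (ℂ ⊗[ℝ] F.line x))

instance (x : M) : TopologicalSpace (F.Complexified x) := moduleTopology ℂ _

instance (x : M) : IsModuleTopology ℂ (F.Complexified x) := ⟨rfl⟩

/-- The complexification of a local frame. -/
def LocalFrame.complexified {F : RegularFoliation I M} (X : F.LocalFrame) (x : M) :
    F.Complexified x := (1 : ℂ) ⊗ₜ[ℝ] X.val x

theorem LocalFrame.complexified_bijective {F : RegularFoliation I M} (X : F.LocalFrame) {x : M}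
    (hx : x ∈ X.dom) : Function.Bijective (fun c : ℂ => c • X.complexified x) := by
  let e : ℝ ≃ₗ[ℝ] F.line x :=
    LinearEquiv.ofBijective (LinearMap.toSpanSingleton ℝ _ (X.val x)) (X.bijective hx)
  let e' : ℂ ≃ₗ[ℝ] ℂ ⊗[ℝ] F.line x :=
    (TensorProduct.rid ℝ ℂ).symm ≪≫ₗ TensorProduct.congr (LinearEquiv.refl ℝ ℂ) e
  have : (fun c : ℂ => c • X.complexified x) = e' := by
    funext c
    change c • ((1 : ℂ) ⊗ₜ[ℝ] X.val x) = c ⊗ₜ[ℝ] ((1 : ℝ) • X.val x)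
    rw [TensorProduct.smul_tmul', one_smul, smul_eq_mul, mul_one]
  rw [this]
  exact e'.bijective

/-- The smooth structure of `F ⊗ ℂ`: its local frames are the complexified local frames of `F`. -/
def complexifiedAtlas : LineFrameAtlas I F.Complexified where
  Index := F.LocalFrame
  dom X := X.dom
  frame X := X.complexified
  isOpen_dom X := X.isOpen_dom
  exists_mem_dom := F.exists_mem_dom
  bijective X _ hx := X.complexified_bijective hx
  smooth_transition X Y := by
    obtain ⟨a, ha, h⟩ := X.exists_transition Y
    refine ⟨fun x => (a x : ℂ), ?_, fun x hx => ?_⟩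
    · exact Complex.ofRealCLM.contDiff.contMDiff.comp_contMDiffOn ha
    · change (1 : ℂ) ⊗ₜ[ℝ] X.val x = (a x : ℂ) • ((1 : ℂ) ⊗ₜ[ℝ] Y.val x)
      rw [h x hx, TensorProduct.smul_tmul', TensorProduct.tmul_smul, TensorProduct.smul_tmul']
      simp

instance : TopologicalSpace (TotalSpace ℂ F.Complexified) :=
  F.complexifiedAtlas.prebundle.totalSpaceTopology

instance : FiberBundle ℂ F.Complexified := F.complexifiedAtlas.prebundle.toFiberBundle

instance : VectorBundle ℂ ℂ F.Complexified := F.complexifiedAtlas.prebundle.toVectorBundle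

theorem complexified_isSmooth : IsSmoothComplexLineBundle I F.Complexified :=
  F.complexifiedAtlas.prebundle_isSmooth

/-- The fibre at `x` of the complex determinant bundle `Λ¹(F ⊗ ℂ)` of `F`. -/
def Det (x : M) : Type _ := ⋀[ℂ]^1 (F.Complexified x)

instance (x : M) : AddCommGroup (F.Det x) := inferInstanceAs (AddCommGroup (⋀[ℂ]^1 (F.Complexified x)))

instance (x : M) : Module ℂ (F.Det x) := inferInstanceAs (Module ℂ (⋀[ℂ]^1 (F.Complexified x)))

instance (x : M) : TopologicalSpace (F.Det x) := moduleTopology ℂ _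

instance (x : M) : IsModuleTopology ℂ (F.Det x) := ⟨rfl⟩

/-- The local frame of the determinant bundle given by a local frame of the foliation. -/
def LocalFrame.det {F : RegularFoliation I M} (X : F.LocalFrame) (x : M) : F.Det x :=
  exteriorPower.ιMulti ℂ 1 (fun _ : Fin 1 => X.complexified x)

/-- The canonical isomorphism `Λ¹ V = V`. -/
def detEquiv (x : M) : F.Det x ≃ₗ[ℂ] F.Complexified x :=
  exteriorPower.oneEquiv ℂ (F.Complexified x)

theorem LocalFrame.det_eq {F : RegularFoliation I M} (X : F.LocalFrame) (x : M) :
    X.det x = (F.detEquiv x).symm (X.complexified x) := by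
  rw [LinearEquiv.eq_symm_apply]
  exact exteriorPower.oneEquiv_ιMulti (R := ℂ) (M := F.Complexified x) _

/-- The smooth structure of `Λ¹(F ⊗ ℂ)`. -/
def detAtlas : LineFrameAtlas I F.Det where
  Index := F.LocalFrame
  dom X := X.dom
  frame X := X.det
  isOpen_dom X := X.isOpen_dom
  exists_mem_dom := F.exists_mem_dom
  bijective X x hx := by
    have : (fun c : ℂ => c • X.det x) = (F.detEquiv x).symm ∘
        (fun c : ℂ => c • X.complexified x) := by
      funext c
      rw [Function.comp_apply, map_smul, X.det_eq]
    rw [this]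
    exact (LinearEquiv.bijective _).comp (X.complexified_bijective hx)
  smooth_transition X Y := by
    obtain ⟨g, hg, h⟩ := F.complexifiedAtlas.smooth_transition X Y
    refine ⟨g, hg, fun x hx => ?_⟩
    have h' : X.complexified x = g x • Y.complexified x := h x hx
    rw [X.det_eq, Y.det_eq, h', map_smul]

instance : TopologicalSpace (TotalSpace ℂ F.Det) := F.detAtlas.prebundle.totalSpaceTopology

instance : FiberBundle ℂ F.Det := F.detAtlas.prebundle.toFiberBundle

instance : VectorBundle ℂ ℂ F.Det := F.detAtlas.prebundle.toVectorBundle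

theorem det_isSmooth : IsSmoothComplexLineBundle I F.Det := F.detAtlas.prebundle_isSmooth

/-- `F` admits a metaplectic correction: its complex determinant bundle `Λ¹(F ⊗ ℂ)` has a square
root among the smooth complex line bundles. -/
def AdmitsMetaplecticCorrection : Prop :=
  ∃ (L : M → Type) (_ : ∀ x, AddCommGroup (L x)) (_ : ∀ x, Module ℂ (L x))
    (_ : TopologicalSpace (TotalSpace ℂ L)) (_ : ∀ x, TopologicalSpace (L x))
    (_ : FiberBundle ℂ L) (_ : VectorBundle ℂ ℂ L),
    IsSmoothComplexLineBundle I L ∧ IsSquareRoot I L F.Det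

end RegularFoliation

end Foliations

/-! ### Čech cohomology and the first Chern class

Čech cohomology is the colimit, over the open covers of `X`, of the cohomology of the complexes of
Čech cochains. The covers `(U x)` indexed by the points of `X` with `x ∈ U x` are cofinal, and
directed under pointwise inclusion; as filtered colimits are exact, the colimit may be taken on
cochains. -/

section Cech

variable (X : Type*) [TopologicalSpace X] (A : Type*) [TopologicalSpace A] [AddCommGroup A]

/-- An open cover of `X` indexed by the points of `X`, such that `x ∈ U x`. -/
structure PointedCover where
  toFun : X → Set X
  isOpen : ∀ x, IsOpen (toFun x)
  mem : ∀ x, x ∈ toFun x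

instance : CoeFun (PointedCover X) (fun _ => X → Set X) := ⟨PointedCover.toFun⟩

variable {X} in
/-- The intersection of two covers. -/
def PointedCover.inter (U V : PointedCover X) : PointedCover X :=
  ⟨fun x => U x ∩ V x, fun x => (U.isOpen x).inter (V.isOpen x), fun x => ⟨U.mem x, V.mem x⟩⟩

instance : Inhabited (PointedCover X) := ⟨⟨fun _ => univ, fun _ => isOpen_univ, fun _ => mem_univ _⟩⟩

/-- Families `c` of functions that, for some cover `U`, restrict to a Čech cochain of degree `n` on
`U` with values in `A`: `c σ` is continuous on `U (σ 0) ∩ ⋯ ∩ U (σ n)`. -/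
def cechCochains [IsTopologicalAddGroup A] (n : ℕ) : AddSubgroup ((Fin (n + 1) → X) → X → A) where
  carrier := {c | ∃ U : PointedCover X, ∀ σ, ContinuousOn (c σ) (⋂ i, U (σ i))}
  zero_mem' := ⟨default, fun _ => continuousOn_const⟩
  add_mem' := by
    rintro c d ⟨U, hU⟩ ⟨V, hV⟩
    exact ⟨U.inter V, fun σ => ((hU σ).mono (iInter_mono fun i => inter_subset_left)).add
      ((hV σ).mono (iInter_mono fun i => inter_subset_right))⟩
  neg_mem' := by
    rintro c ⟨U, hU⟩
    exact ⟨U, fun σ => (hU σ).neg⟩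

/-- Families that vanish as a Čech cochain on some cover. -/
def cechNull (n : ℕ) : AddSubgroup ((Fin (n + 1) → X) → X → A) where
  carrier := {c | ∃ U : PointedCover X, ∀ σ, ∀ z ∈ ⋂ i, U (σ i), c σ z = 0}
  zero_mem' := ⟨default, fun _ _ _ => rfl⟩
  add_mem' := by
    rintro c d ⟨U, hU⟩ ⟨V, hV⟩
    refine ⟨U.inter V, fun σ z hz => ?_⟩
    have h1 := hU σ z (iInter_mono (fun i => inter_subset_left) hz)
    have h2 := hV σ z (iInter_mono (fun i => inter_subset_right) hz)
    simp [h1, h2]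
  neg_mem' := by
    rintro c ⟨U, hU⟩
    exact ⟨U, fun σ z hz => by simp [hU σ z hz]⟩

/-- The Čech differential,
`(d c) (x₀, …, xₙ₊₁) = ∑ i, (-1) ^ i • c (x₀, …, omit xᵢ, …, xₙ₊₁)`. -/
def cechD (n : ℕ) : ((Fin (n + 1) → X) → X → A) →+ ((Fin (n + 2) → X) → X → A) where
  toFun c σ z := ∑ i : Fin (n + 2), (-1 : ℤ) ^ (i : ℕ) • c (fun j => σ (i.succAbove j)) z
  map_zero' := by
    funext σ z
    simp
  map_add' c d := by
    funext σ z
    simp [Finset.sum_add_distrib]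

/-- Čech cocycles of degree `n`. -/
def cechCocycles [IsTopologicalAddGroup A] (n : ℕ) : AddSubgroup ((Fin (n + 1) → X) → X → A) :=
  cechCochains X A n ⊓ (cechNull X A (n + 1)).comap (cechD X A n)

/-- Families that agree on some cover with a Čech coboundary of degree `n + 1`. -/
def cechCoboundaries [IsTopologicalAddGroup A] (n : ℕ) :
    AddSubgroup ((Fin (n + 2) → X) → X → A) :=
  (cechCochains X A n).map (cechD X A n) ⊔ cechNull X A (n + 1)

/-- The Čech cohomology group `H²(X; A)` with coefficients in (the sheaf of continuous functions
with values in) `A`; for discrete `A`, this is the constant sheaf. -/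
abbrev CechH2 [IsTopologicalAddGroup A] : Type _ :=
  cechCocycles X A 2 ⧸ (cechCoboundaries X A 1).addSubgroupOf (cechCocycles X A 2)

variable {X}

/-- `c` is the first Chern class of the complex line bundle `L`, that is, the image of the class of
`L` under the connecting map `H¹(X; ℂˣ) → H²(X; ℤ)` of the exponential sequence
`0 → ℤ → ℂ → ℂˣ → 1`. On a cover `U` over which `L` is trivialized, with transition functions
`g x y = ψ x ∘ (ψ y)⁻¹`, one chooses continuous logarithms `g x y = exp (2 π i f x y)`; then `c` is
the class of the integral cocycle `d f`. -/
def IsFirstChernClass (L : X → Type*) [∀ x, AddCommGroup (L x)] [∀ x, Module ℂ (L x)]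
    [TopologicalSpace (TotalSpace ℂ L)] [∀ x, TopologicalSpace (L x)] [FiberBundle ℂ L]
    [VectorBundle ℂ ℂ L] (c : CechH2 X ℤ) : Prop :=
  ∃ (U : PointedCover X) (f : (Fin 2 → X) → X → ℂ) (a : cechCocycles X ℤ 2),
    (∀ x, U x ⊆ (trivializationAt ℂ L x).baseSet) ∧
    (∀ σ, ContinuousOn (f σ) (⋂ i, U (σ i))) ∧
    (∀ σ, ∀ z ∈ ⋂ i, U (σ i), Complex.exp (2 * Real.pi * Complex.I * f σ z) =
      (trivializationAt ℂ L (σ 1)).coordChangeL ℂ (trivializationAt ℂ L (σ 0)) z 1) ∧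
    (∀ σ, ∀ z ∈ ⋂ i, U (σ i), (((a : (Fin 3 → X) → X → ℤ) σ z : ℤ) : ℂ) = cechD X ℂ 1 f σ z) ∧
    c = QuotientAddGroup.mk a

end Cech

/-- The torus `𝕋²`, as a smooth manifold modelled on `𝓡 1 × 𝓡 1`. -/
abbrev Torus : Type := Circle × Circle

end

/-!
The tangent bundle of the torus is parallelizable, and a parallelization can be packaged as a single
complex-valued `1`-form `α = dθ₁ + i dθ₂` which is injective (as a real linear map) on every tangent
space: this is `torusCoframe`. Its restriction to the line `F x` is a nonzero real linear map to
`ℂ`, so its complex linear extension `F x ⊗ ℂ → ℂ`, `c ⊗ v ↦ c * α v`, is a nonzero map between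
complex lines, hence an isomorphism (`RegularFoliation.coframeEquiv`). It depends smoothly on `x`,
because `α` sends smooth vector fields to smooth functions. Thus `F ⊗ ℂ` is trivial, although `F`
itself need not be: a sign change of a local generator `X` changes the sign of `α X` too, so the
section `(α X)⁻¹ ⊗ X` of `F ⊗ ℂ` does not depend on the choice of `X`.

The isomorphism `Λ¹ V = V` carries the trivialization over to the determinant bundle `N`, and
the multiplication `ℂ ⊗ ℂ ≃ ℂ` then exhibits the trivial bundle as a square root of `N`.

For the Chern class, let `hₓ` be the function that a global trivialization assigns to the unit
section of the local trivialization at `x`. The transition functions are quotients of the `hₓ`. On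
small neighbourhoods `hₓ = exp (2 π i lₓ)`, so any logarithm of the transition functions is a
coboundary of the `lₓ` plus an integral cochain, and its differential is an integral coboundary
(`isFirstChernClass_iff_eq_zero`). This gives that `0` is a first Chern class and that it is the
only one.
-/

/-! ### A complex coframe on the torus -/

noncomputable section Coframe

open scoped ComplexConjugate

attribute [local instance] finrank_real_complex_fact'

theorem Circle.contMDiff_coe : ContMDiff (𝓡 1) 𝓘(ℝ, ℂ) ∞ (fun z : Circle => (z : ℂ)) :=
  contMDiff_coe_sphere

theorem Circle.mvfderiv_coe_injective (z : Circle) :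
    Function.Injective (mvfderiv (𝓡 1) (fun z : Circle => (z : ℂ)) z) :=
  injective_mvfderiv_subtypeVal_sphere (E := ℂ) (n := 1) z

/-- Tangent vectors to the circle at `z` are real multiples of `i z`. -/
theorem Circle.re_conj_mul_mvfderiv_coe (z : Circle) (v : TangentSpace (𝓡 1) z) :
    (conj (z : ℂ) * mvfderiv (𝓡 1) (fun z : Circle => (z : ℂ)) z v).re = 0 := by
  have h := range_mvfderiv_subtypeVal (E := ℂ) (n := 1) z
  have h2 : mvfderiv (𝓡 1) (fun z : Circle => (z : ℂ)) z v ∈ (ℝ ∙ (z : ℂ))ᗮ :=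
    h ▸ LinearMap.mem_range_self _ v
  rw [Submodule.mem_orthogonal_singleton_iff_inner_right] at h2
  simpa [Complex.inner, mul_comm] using h2

theorem Circle.eq_zero_of_im_conj_mul_mvfderiv_coe (z : Circle) (v : TangentSpace (𝓡 1) z)
    (h : (conj (z : ℂ) * mvfderiv (𝓡 1) (fun z : Circle => (z : ℂ)) z v).im = 0) : v = 0 := by
  have h0 : conj (z : ℂ) * mvfderiv (𝓡 1) (fun z : Circle => (z : ℂ)) z v = 0 :=
    Complex.ext (z.re_conj_mul_mvfderiv_coe v) h
  have hz : conj (z : ℂ) ≠ 0 := by simp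
  have h1 := (mul_eq_zero.1 h0).resolve_left hz
  exact z.mvfderiv_coe_injective (h1.trans (map_zero _).symm)

/-- The derivative of a smooth function along a smooth vector field is smooth. -/
theorem ContMDiffOn.mvfderiv_apply_section {E H M G : Type*} [NormedAddCommGroup E]
    [NormedSpace ℝ E] [TopologicalSpace H] {I : ModelWithCorners ℝ E H} [TopologicalSpace M]
    [ChartedSpace H M] [IsManifold I ∞ M] [NormedAddCommGroup G] [NormedSpace ℝ G] {f : M → G}
    (hf : ContMDiff I 𝓘(ℝ, G) ∞ f) {U : Set M} {X : ∀ x : M, TangentSpace I x}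
    (hX : ContMDiffOn I I.tangent ∞ (fun x => (⟨x, X x⟩ : TangentBundle I M)) U) :
    ContMDiffOn I 𝓘(ℝ, G) ∞ (fun x => mvfderiv I f x (X x)) U :=
  (contMDiff_snd_tangentBundle_modelSpace G 𝓘(ℝ, G)).comp_contMDiffOn
    ((hf.contMDiff_tangentMap le_rfl).comp_contMDiffOn hX)

/-- The complex-valued `1`-form `dθ₁ + i dθ₂` on the torus. The angular form of a circle-valued
function `c` is written as `Im (conj c * dc)`, where `dc` is the derivative of `c` as a function
with values in `ℂ`. -/
def torusCoframe (p : Torus) : TangentSpace ((𝓡 1).prod (𝓡 1)) p →ₗ[ℝ] ℂ where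
  toFun v :=
    ⟨(conj (p.1 : ℂ) * mvfderiv ((𝓡 1).prod (𝓡 1)) (fun q : Torus => (q.1 : ℂ)) p v).im,
      (conj (p.2 : ℂ) * mvfderiv ((𝓡 1).prod (𝓡 1)) (fun q : Torus => (q.2 : ℂ)) p v).im⟩
  map_add' v w := by
    apply Complex.ext <;> simp only [map_add, mul_add, Complex.add_im, Complex.add_re]
  map_smul' a v := by
    apply Complex.ext <;>
      simp only [map_smul, mul_smul_comm, Complex.smul_im, Complex.smul_re, RingHom.id_apply]

theorem torusCoframe_injective (p : Torus) : Function.Injective (torusCoframe p) := by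
  rw [injective_iff_map_eq_zero]
  intro v hv
  have hv1 := congrArg Complex.re hv
  have hv2 := congrArg Complex.im hv
  have e1 : mvfderiv ((𝓡 1).prod (𝓡 1)) (fun q : Torus => (q.1 : ℂ)) p v
      = mvfderiv (𝓡 1) (fun z : Circle => (z : ℂ)) p.1 v.1 := by
    have h := mfderiv_comp_apply (𝕜 := ℝ) (I := (𝓡 1).prod (𝓡 1)) (I' := 𝓡 1) (I'' := 𝓘(ℝ, ℂ))
      (g := fun z : Circle => (z : ℂ))
      (f := (Prod.fst : Torus → Circle)) p
      ((Circle.contMDiff_coe p.1).mdifferentiableAt (by simp))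
      (contMDiff_fst.mdifferentiableAt (n := ∞) (by simp)) v
    rw [mfderiv_fst] at h
    exact h
  have e2 : mvfderiv ((𝓡 1).prod (𝓡 1)) (fun q : Torus => (q.2 : ℂ)) p v
      = mvfderiv (𝓡 1) (fun z : Circle => (z : ℂ)) p.2 v.2 := by
    have h := mfderiv_comp_apply (𝕜 := ℝ) (I := (𝓡 1).prod (𝓡 1)) (I' := 𝓡 1) (I'' := 𝓘(ℝ, ℂ))
      (g := fun z : Circle => (z : ℂ))
      (f := (Prod.snd : Torus → Circle)) p
      ((Circle.contMDiff_coe p.2).mdifferentiableAt (by simp))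
      (contMDiff_snd.mdifferentiableAt (n := ∞) (by simp)) v
    rw [mfderiv_snd] at h
    exact h
  refine Prod.ext (p.1.eq_zero_of_im_conj_mul_mvfderiv_coe v.1 ?_)
    (p.2.eq_zero_of_im_conj_mul_mvfderiv_coe v.2 ?_)
  · rw [← e1]; exact hv1
  · rw [← e2]; exact hv2

theorem torusCoframe_contMDiffOn {U : Set Torus}
    {X : ∀ x : Torus, TangentSpace ((𝓡 1).prod (𝓡 1)) x}
    (hX : ContMDiffOn ((𝓡 1).prod (𝓡 1)) ((𝓡 1).prod (𝓡 1)).tangent ∞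
      (fun x => (⟨x, X x⟩ : TangentBundle ((𝓡 1).prod (𝓡 1)) Torus)) U) :
    ContMDiffOn ((𝓡 1).prod (𝓡 1)) 𝓘(ℝ, ℂ) ∞ (fun x => torusCoframe x (X x)) U := by
  have key : ∀ c : Torus → Circle, ContMDiff ((𝓡 1).prod (𝓡 1)) (𝓡 1) ∞ c →
      ContMDiffOn ((𝓡 1).prod (𝓡 1)) 𝓘(ℝ, ℝ) ∞ (fun x =>
        (conj (c x : ℂ) * mvfderiv ((𝓡 1).prod (𝓡 1)) (fun q => (c q : ℂ)) x (X x)).im) U := by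
    intro c hc
    have hc' := Circle.contMDiff_coe.comp hc
    have h1 := ContMDiffOn.mvfderiv_apply_section hc' hX
    have h2 := Complex.conjCLE.contDiff (n := ∞).contMDiff.comp hc'
    exact Complex.imCLM.contDiff.contMDiff.comp_contMDiffOn
      ((contDiff_mul (𝕜 := ℝ) (𝔸 := ℂ)).contMDiff.comp_contMDiffOn (h2.contMDiffOn.prodMk_space h1))
  exact Complex.equivRealProdCLM.symm.contDiff.contMDiff.comp_contMDiffOn
    ((key _ contMDiff_fst).prodMk_space (key _ contMDiff_snd))

end Coframe

/-! ### The first Chern class of a trivializable line bundle -/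

section Chern

variable {X : Type*} [TopologicalSpace X]

/-- A continuous function that does not vanish at `x` has a continuous logarithm near `x`,
normalized as in the exponential sequence. -/
theorem exists_continuousOn_log {h : X → ℂ} {x : X} {U : Set X} (hU : IsOpen U) (hx : x ∈ U)
    (hc : ContinuousOn h U) (h0 : h x ≠ 0) :
    ∃ V ⊆ U, IsOpen V ∧ x ∈ V ∧ ∃ l : X → ℂ, ContinuousOn l V ∧
      ∀ z ∈ V, Complex.exp (2 * Real.pi * Complex.I * l z) = h z := by
  have hq : ContinuousOn (fun z => h z / h x) U := hc.div_const _
  refine ⟨U ∩ (fun z => h z / h x) ⁻¹' Complex.slitPlane, inter_subset_left,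
    hq.isOpen_inter_preimage hU Complex.isOpen_slitPlane, ⟨hx, by simp [h0]⟩,
    -- Near `x` the quotient `h z / h x` is close to `1`, away from the branch cut of `log`.
    fun z => (Complex.log (h z / h x) + Complex.log (h x)) / (2 * Real.pi * Complex.I), ?_, ?_⟩
  · exact (((hq.mono inter_subset_left).clog fun z hz => hz.2).add continuousOn_const).div_const _
  · intro z hz
    rw [mul_div_cancel₀ _ Complex.two_pi_I_ne_zero, Complex.exp_add,
      Complex.exp_log (Complex.slitPlane_ne_zero hz.2), Complex.exp_log h0, div_mul_cancel₀ _ h0]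

variable {L : X → Type*} [∀ x, AddCommGroup (L x)] [∀ x, Module ℂ (L x)]
  [TopologicalSpace (TotalSpace ℂ L)] [∀ x, TopologicalSpace (L x)] [FiberBundle ℂ L]
  [VectorBundle ℂ ℂ L]

/-- In terms of a global trivialization `Ω`, the transition function from `e` to `e'` is the
quotient of the values of `Ω` on the unit sections of `e` and `e'`. -/
theorem coordChangeL_one_mul (Ω : ∀ x, L x ≃ₗ[ℂ] ℂ) (e e' : Trivialization ℂ (π ℂ L))
    [MemTrivializationAtlas e] [MemTrivializationAtlas e'] {z : X} (hz : z ∈ e.baseSet)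
    (hz' : z ∈ e'.baseSet) :
    e.coordChangeL ℂ e' z 1 * Ω z (e'.symm z 1) = Ω z (e.symm z 1) := by
  rw [e.coordChangeL_apply e' ⟨hz, hz'⟩, ← smul_eq_mul, ← map_smul]
  have h := (e'.symmₗ ℂ z).map_smul (e' ⟨z, e.symm z 1⟩).2 1
  simp only [e'.symmₗ_apply hz', smul_eq_mul, mul_one] at h
  rw [← h, e'.symm_apply_apply_mk hz']

/-- A line bundle with a continuous global trivialization `Ω` has first Chern class zero, and no
other. Continuity of `Ω` is expressed through the unit sections of the local trivializations. -/
theorem isFirstChernClass_iff_eq_zero (Ω : ∀ x, L x ≃ₗ[ℂ] ℂ)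
    (hΩ : ∀ x, ContinuousOn (fun z => Ω z ((trivializationAt ℂ L x).symm z 1))
      (trivializationAt ℂ L x).baseSet) (c : CechH2 X ℤ) :
    IsFirstChernClass L c ↔ c = 0 := by
  have hne : ∀ x, Ω x ((trivializationAt ℂ L x).symm x 1) ≠ 0 := by
    intro x h
    rw [LinearEquiv.map_eq_zero_iff] at h
    have h1 := (trivializationAt ℂ L x).apply_mk_symm (mem_baseSet_trivializationAt ℂ L x) 1
    rw [h] at h1
    have h2 := h1.symm.trans
      ((trivializationAt ℂ L x).zeroSection ℂ (mem_baseSet_trivializationAt ℂ L x))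
    simp at h2
  have hlog := fun x => exists_continuousOn_log (trivializationAt ℂ L x).open_baseSet
    (mem_baseSet_trivializationAt ℂ L x) (hΩ x) (hne x)
  choose V hVb hVo hVm l hl hexp using hlog
  let W : PointedCover X := ⟨V, hVo, hVm⟩
  have hW : ∀ σ : Fin 2 → X, ∀ z ∈ ⋂ i, W (σ i), ∀ i, z ∈ V (σ i) := fun σ z hz i =>
    mem_iInter.1 hz i
  have hf : ∀ σ : Fin 2 → X, ∀ z ∈ ⋂ i, W (σ i),
      Complex.exp (2 * Real.pi * Complex.I * (l (σ 1) z - l (σ 0) z)) =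
      (trivializationAt ℂ L (σ 1)).coordChangeL ℂ (trivializationAt ℂ L (σ 0)) z 1 := by
    intro σ z hz
    have h0 := hW σ z hz 0
    have h1 := hW σ z hz 1
    have h := coordChangeL_one_mul Ω (trivializationAt ℂ L (σ 1)) (trivializationAt ℂ L (σ 0))
      (hVb _ h1) (hVb _ h0)
    rw [← hexp _ z h0, ← hexp _ z h1] at h
    rw [mul_sub, Complex.exp_sub, ← h, mul_div_cancel_right₀ _ (Complex.exp_ne_zero _)]
  have hlc : ∀ σ : Fin 2 → X,
      ContinuousOn (fun z => l (σ 1) z - l (σ 0) z) (⋂ i, W (σ i)) := fun σ =>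
    ((hl (σ 1)).mono (iInter_subset _ 1)).sub ((hl (σ 0)).mono (iInter_subset _ 0))
  have hd : cechD X ℂ 1 (fun σ z => l (σ 1) z - l (σ 0) z) = 0 := by
    funext σ z
    simp [cechD, Fin.sum_univ_succ, Fin.succAbove]
  constructor
  · rintro ⟨U, f, a, hUb, hfc, hfe, ha, rfl⟩
    rw [QuotientAddGroup.eq_zero_iff, AddSubgroup.mem_addSubgroupOf]
    -- The two logarithms `f σ` and `l (σ 1) - l (σ 0)` of the transition functions differ by an
    -- integer, extracted by `round`; the differential of `n` is that of `f`, hence equal to `a`.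
    let n : (Fin 2 → X) → X → ℤ := fun σ z => round (f σ z - (l (σ 1) z - l (σ 0) z)).re
    have hn : ∀ σ, ∀ z ∈ ⋂ i, (U.inter W) (σ i),
        ((n σ z : ℤ) : ℂ) = f σ z - (l (σ 1) z - l (σ 0) z) := by
      intro σ z hz
      have h1 := hfe σ z (iInter_mono (fun i => inter_subset_left) hz)
      rw [← hf σ z (iInter_mono (fun i => inter_subset_right) hz),
        Complex.exp_eq_exp_iff_exists_int] at h1
      obtain ⟨m, hm⟩ := h1
      have h2 : f σ z - (l (σ 1) z - l (σ 0) z) = m := by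
        apply mul_left_cancel₀ Complex.two_pi_I_ne_zero
        linear_combination hm
      simp only [n, h2, Complex.intCast_re, round_intCast]
    refine AddSubgroup.mem_sup.2 ⟨cechD X ℤ 1 n, ⟨n, ⟨U.inter W, fun σ => ?_⟩, rfl⟩,
      (a : (Fin 3 → X) → X → ℤ) - cechD X ℤ 1 n, ⟨U.inter W, fun σ z hz => ?_⟩,
      add_sub_cancel _ _⟩
    · have h : ContinuousOn (fun z => ((n σ z : ℤ) : ℂ)) (⋂ i, (U.inter W) (σ i)) :=
        (((hfc σ).mono (iInter_mono fun i => inter_subset_left)).sub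
          ((hlc σ).mono (iInter_mono fun i => inter_subset_right))).congr
          (hn σ)
      have h' := Complex.continuous_re.comp_continuousOn h
      exact Int.isClosedEmbedding_coe_real.isInducing.continuousOn_iff.2 h'
    · have h1 := ha σ z (iInter_mono (fun i => inter_subset_left) hz)
      have h3 : ∀ i : Fin 3, z ∈ ⋂ j, (U.inter W) (σ (i.succAbove j)) := fun i =>
        mem_iInter.2 fun j => mem_iInter.1 hz _
      have h4 : ((cechD X ℤ 1 n σ z : ℤ) : ℂ) = cechD X ℂ 1 f σ z := by
        rw [← sub_zero (cechD X ℂ 1 f), ← hd, ← map_sub]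
        simp only [cechD, AddMonoidHom.coe_mk, ZeroHom.coe_mk, zsmul_eq_mul, Int.cast_sum,
          Int.cast_mul, Int.cast_id]
        exact Finset.sum_congr rfl fun i _ => congrArg _ (hn _ _ (h3 i))
      rw [← h1] at h4
      simp only [Pi.sub_apply, sub_eq_zero]
      exact_mod_cast h4.symm
  · rintro rfl
    refine ⟨W, fun σ z => l (σ 1) z - l (σ 0) z, 0, hVb, hlc, hf, fun σ z _ => ?_, rfl⟩
    rw [hd]
    simp

end Chern

/-! ### Smooth sections of line bundles given by local frames -/

noncomputable section Frames

variable {EM H M : Type*} [NormedAddCommGroup EM] [NormedSpace ℝ EM] [TopologicalSpace H]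
  [TopologicalSpace M] [ChartedSpace H M] {I : ModelWithCorners ℝ EM H}

/-- Multiplication of complex-valued functions preserves smoothness over `ℝ`; `ContMDiffAt.mul` does
not apply, as the `ContMDiffMul` instance of a field `𝕜` concerns `𝕜` as a manifold over itself. -/
theorem ContMDiffAt.complex_mul {f g : M → ℂ} {x : M} (hf : ContMDiffAt I 𝓘(ℝ, ℂ) ∞ f x)
    (hg : ContMDiffAt I 𝓘(ℝ, ℂ) ∞ g x) : ContMDiffAt I 𝓘(ℝ, ℂ) ∞ (fun y => f y * g y) x :=
  (contDiff_mul (𝕜 := ℝ) (𝔸 := ℂ)).contMDiff.contMDiffAt.comp x (hf.prodMk_space hg)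

theorem ContMDiffAt.complex_inv {f : M → ℂ} {x : M} (hf : ContMDiffAt I 𝓘(ℝ, ℂ) ∞ f x)
    (h0 : f x ≠ 0) : ContMDiffAt I 𝓘(ℝ, ℂ) ∞ (fun y => (f y)⁻¹) x :=
  (contDiffAt_inv ℝ h0).contMDiffAt.comp x hf

namespace LineFrameAtlas

variable {E : M → Type*} [∀ x, AddCommGroup (E x)] [∀ x, Module ℂ (E x)] (A : LineFrameAtlas I E)
  [∀ x, TopologicalSpace (E x)] [∀ x, IsModuleTopology ℂ (E x)]

/-- If the fibrewise isomorphisms `Ω` are smooth on the local frames of the atlas, then they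
identify smooth sections with smooth functions. -/
theorem smoothSectionAt_iff (Ω : ∀ x, E x ≃ₗ[ℂ] ℂ)
    (hΩ : ∀ i, ContMDiffOn I 𝓘(ℝ, ℂ) ∞ (fun x => Ω x (A.frame i x)) (A.dom i)) (x₀ : M)
    (s : ∀ x, E x) :
    letI := A.prebundle.totalSpaceTopology
    letI := A.prebundle.toFiberBundle
    SmoothSectionAt I s x₀ ↔ ContMDiffAt I 𝓘(ℝ, ℂ) ∞ (fun x => Ω x (s x)) x₀ := by
  let := A.prebundle.totalSpaceTopology
  let := A.prebundle.toFiberBundle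
  have hx := (A.exists_mem_dom x₀).choose_spec
  set i := (A.exists_mem_dom x₀).choose
  have h1 : SmoothSectionAt I s x₀ ↔ ContMDiffAt I 𝓘(ℝ, ℂ) ∞ (fun x => A.coord i x (s x)) x₀ :=
    contMDiffAt_section x₀
  have hnhds := (A.isOpen_dom i).mem_nhds hx
  have hfr := (hΩ i).contMDiffAt hnhds
  have hmul : ∀ x ∈ A.dom i, Ω x (s x) = A.coord i x (s x) * Ω x (A.frame i x) := fun x hx => by
    rw [← smul_eq_mul, ← map_smul, A.coord_smul_frame' hx]
  have hne : ∀ x ∈ A.dom i, Ω x (A.frame i x) ≠ 0 := by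
    intro x hx h
    have h2 := (A.bijective i x hx).1.ne (one_ne_zero : (1 : ℂ) ≠ 0)
    simp [(Ω x).map_eq_zero_iff.1 h] at h2
  rw [h1]
  constructor
  · intro h
    refine (h.complex_mul hfr).congr_of_eventuallyEq ?_
    filter_upwards [hnhds] with x hx using hmul x hx
  · intro h
    refine (h.complex_mul (hfr.complex_inv (hne x₀ hx))).congr_of_eventuallyEq ?_
    filter_upwards [hnhds] with x hx
    rw [hmul x hx, mul_inv_cancel_right₀ (hne x hx)]

/-- Fibrewise isomorphisms that are smooth on the local frames are continuous on the unit sections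
of the preferred trivializations, which are local frames of the atlas. -/
theorem continuousOn_trivializationAt_symm (Ω : ∀ x, E x ≃ₗ[ℂ] ℂ)
    (hΩ : ∀ i, ContMDiffOn I 𝓘(ℝ, ℂ) ∞ (fun x => Ω x (A.frame i x)) (A.dom i)) (x : M) :
    letI := A.prebundle.totalSpaceTopology
    letI := A.prebundle.toFiberBundle
    ContinuousOn (fun z => Ω z ((trivializationAt ℂ E x).symm z 1))
      (trivializationAt ℂ E x).baseSet := by
  let := A.prebundle.totalSpaceTopology
  let := A.prebundle.toFiberBundle
  refine (hΩ (A.exists_mem_dom x).choose).continuousOn.congr fun z hz => congrArg (Ω z) ?_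
  exact (A.pretriv_symm _ hz 1).trans (one_smul ℂ _)

end LineFrameAtlas

/-! ### The trivial line bundle -/

theorem isSmoothComplexLineBundle_trivial :
    IsSmoothComplexLineBundle I (Bundle.Trivial M ℂ) := by
  intro e e' _ _
  obtain rfl := Bundle.Trivial.eq_trivialization M ℂ e
  obtain rfl := Bundle.Trivial.eq_trivialization M ℂ e'
  simp only [Bundle.Trivial.trivialization.coordChangeL]
  exact contMDiffOn_const

theorem smoothSectionAt_trivial_iff (s : M → ℂ) (x₀ : M) :
    SmoothSectionAt I (L := Bundle.Trivial M ℂ) s x₀ ↔ ContMDiffAt I 𝓘(ℝ, ℂ) ∞ s x₀ :=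
  contMDiffAt_section x₀

theorem isSquareRoot_trivial_of_iso {N : M → Type*} [∀ x, AddCommGroup (N x)]
    [∀ x, Module ℂ (N x)] [TopologicalSpace (TotalSpace ℂ N)] [∀ x, TopologicalSpace (N x)]
    [FiberBundle ℂ N] {φ : ∀ x, Bundle.Trivial M ℂ x ≃ₗ[ℂ] N x}
    (hφ : IsSmoothLineBundleIso I φ) : IsSquareRoot I (Bundle.Trivial M ℂ) N := by
  -- `L x ⊗ L x = ℂ ⊗ ℂ ≃ ℂ` by multiplication, followed by `φ`.
  refine ⟨fun x => TensorProduct.lid ℂ ℂ ≪≫ₗ φ x, fun x₀ s t hs ht => ?_⟩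
  refine (hφ x₀ fun x => (s x * t x : ℂ)).1 ?_
  rw [smoothSectionAt_trivial_iff] at hs ht ⊢
  exact hs.complex_mul ht

/-! ### Trivializing the complexification of a foliation -/

namespace RegularFoliation

variable [IsManifold I ∞ M] (F : RegularFoliation I M)
  (α : ∀ x : M, TangentSpace I x →ₗ[ℝ] ℂ)

/-- The complex linear extension `c ⊗ v ↦ c * α v` to `F ⊗ ℂ` of the restriction to `F` of the
complex-valued `1`-form `α`. -/
def coframeMap (x : M) : F.Complexified x →ₗ[ℂ] ℂ :=
  LinearMap.liftBaseChange ℂ ((α x).domRestrict (F.line x))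

theorem coframeMap_complexified (X : F.LocalFrame) {x : M} (hx : x ∈ X.dom) :
    F.coframeMap α x (X.complexified x) = α x (X.field x) := by
  rw [← X.coe_val hx]
  exact (LinearMap.liftBaseChange_tmul ..).trans (one_smul ℂ _)

theorem coframeMap_bijective (hα : ∀ x, Function.Injective (α x)) (x : M) :
    Function.Bijective (F.coframeMap α x) := by
  obtain ⟨X, hx⟩ := F.exists_mem_dom x
  have hne : α x (X.field x) ≠ 0 := fun h => X.ne_zero x hx (hα x (h.trans (map_zero _).symm))
  refine (Function.Bijective.of_comp_iff _ (X.complexified_bijective hx)).1 ?_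
  have : F.coframeMap α x ∘ (fun c : ℂ => c • X.complexified x) =
      fun c => c * α x (X.field x) := by
    funext c
    simp only [Function.comp_apply, map_smul, F.coframeMap_complexified α X hx, smul_eq_mul]
  rw [this]
  exact mulRight_bijective₀ _ hne

/-- The trivialization of `F ⊗ ℂ` given by a complex-valued `1`-form that is injective on every
tangent space. -/
def coframeEquiv (hα : ∀ x, Function.Injective (α x)) (x : M) : F.Complexified x ≃ₗ[ℂ] ℂ :=
  LinearEquiv.ofBijective _ (F.coframeMap_bijective α hα x)

theorem coframeEquiv_contMDiffOn (hα : ∀ x, Function.Injective (α x))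
    (hs : ∀ X : F.LocalFrame, ContMDiffOn I 𝓘(ℝ, ℂ) ∞ (fun x => α x (X.field x)) X.dom)
    (X : F.LocalFrame) :
    ContMDiffOn I 𝓘(ℝ, ℂ) ∞ (fun x => F.coframeEquiv α hα x (X.complexified x)) X.dom :=
  (hs X).congr fun _ hx => F.coframeMap_complexified α X hx

theorem smoothSectionAt_det_iff (hα : ∀ x, Function.Injective (α x))
    (hs : ∀ X : F.LocalFrame, ContMDiffOn I 𝓘(ℝ, ℂ) ∞ (fun x => α x (X.field x)) X.dom)
    (x₀ : M) (s : ∀ x, F.Det x) :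
    SmoothSectionAt I s x₀ ↔
      ContMDiffAt I 𝓘(ℝ, ℂ) ∞ (fun x => F.coframeEquiv α hα x (F.detEquiv x (s x))) x₀ := by
  refine F.detAtlas.smoothSectionAt_iff (fun x => F.detEquiv x ≪≫ₗ F.coframeEquiv α hα x)
    (fun X => (F.coframeEquiv_contMDiffOn α hα hs X).congr fun x _ => ?_) x₀ s
  change F.coframeEquiv α hα x (F.detEquiv x (X.det x)) = _
  rw [X.det_eq, LinearEquiv.apply_symm_apply]

theorem isFirstChernClass_complexified_iff (hα : ∀ x, Function.Injective (α x))
    (hs : ∀ X : F.LocalFrame, ContMDiffOn I 𝓘(ℝ, ℂ) ∞ (fun x => α x (X.field x)) X.dom)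
    (c : CechH2 M ℤ) :
    IsFirstChernClass F.Complexified c ↔ c = 0 :=
  isFirstChernClass_iff_eq_zero (F.coframeEquiv α hα)
    (F.complexifiedAtlas.continuousOn_trivializationAt_symm _
      (F.coframeEquiv_contMDiffOn α hα hs)) c

theorem exists_trivial_iso_det (hα : ∀ x, Function.Injective (α x))
    (hs : ∀ X : F.LocalFrame, ContMDiffOn I 𝓘(ℝ, ℂ) ∞ (fun x => α x (X.field x)) X.dom) :
    ∃ φ : ∀ x, Bundle.Trivial M ℂ x ≃ₗ[ℂ] F.Det x, IsSmoothLineBundleIso I φ := by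
  refine ⟨fun x => (F.detEquiv x ≪≫ₗ F.coframeEquiv α hα x).symm, fun x₀ s => ?_⟩
  rw [F.smoothSectionAt_det_iff α hα hs, smoothSectionAt_trivial_iff]
  refine iff_of_eq (congrArg (ContMDiffAt I 𝓘(ℝ, ℂ) ∞ · x₀) (funext fun x => ?_))
  exact ((F.detEquiv x ≪≫ₗ F.coframeEquiv α hα x).apply_symm_apply (s x)).symm

end RegularFoliation

end Frames

/-- Every regular foliation of the torus admits a metaplectic correction: the complexified line
bundle has vanishing first Chern class, the complex determinant bundle is trivial, and the trivial
bundle is a square root of it. -/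
theorem mainTheorem11 (F : RegularFoliation ((𝓡 1).prod (𝓡 1)) Torus) :
    F.AdmitsMetaplecticCorrection ∧
    (∀ c : CechH2 Torus ℤ, IsFirstChernClass F.Complexified c ↔ c = 0) ∧
    (∃ φ : ∀ x, Bundle.Trivial Torus ℂ x ≃ₗ[ℂ] F.Det x,
      IsSmoothLineBundleIso ((𝓡 1).prod (𝓡 1)) φ) ∧
    IsSquareRoot ((𝓡 1).prod (𝓡 1)) (Bundle.Trivial Torus ℂ) F.Det := by
  have hs := fun X : F.LocalFrame => torusCoframe_contMDiffOn X.smooth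
  have hiso := F.exists_trivial_iso_det torusCoframe torusCoframe_injective hs
  have hroot : IsSquareRoot ((𝓡 1).prod (𝓡 1)) (Bundle.Trivial Torus ℂ) F.Det :=
    isSquareRoot_trivial_of_iso hiso.choose_spec
  exact ⟨⟨Bundle.Trivial Torus ℂ, inferInstance, inferInstance, inferInstance, inferInstance,
      inferInstance, inferInstance, isSmoothComplexLineBundle_trivial, hroot⟩,
    F.isFirstChernClass_complexified_iff torusCoframe torusCoframe_injective hs, hiso, hroot⟩
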